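/- **Setting.** Let $S$ be a smooth surface and let $L_i,L_j\subset S$ be two smooth curves crossing normally at a point $P$; that is, $\mathcal O_{S,P}$ is a regular local ring of dimension $2$, $L_i=\{x=0\}$ and $L_j=\{y=0\}$ near $P$, and $x,y$ generate the maximal ideal of $\mathcal O_{S,P}$. On a surface obtained from $S$ by successively blowing up, over $P$, points where two of the curves (strict preimages of $L_i,L_j$ and exceptional curves) cross, these curves are called *visible*. Visible curves on different blowups are identified if they are strict preimages of each other, i.e. have the same local ring in the function field of $S$. Start with the dual graph $\{v_i,v_j\}$ of $L_i,L_j$, drawn from left to right, a single edge with both marks $0$. Blow up $P$; after each blowup, with exceptional curve $E$, either stop or blow up the intersection point of $E$ with its left (L) or right (R) neighbour. Each blowup inserts a vertex with mark $1$ on the edge of the blown-up point and increases the marks of the two ends of this edge by $1$. So the procedure is encoded by a finite, possibly empty, binary sequence in L, R. Let $f\colon Y\to S$ be the result, $\Gamma$ the final graph (a chain), and $E$ the last exceptional curve, a $(-1)$-curve. Its weight vector is $(w_i,w_j)$, where $w_i$ and $w_j$ are the coefficients of $E$ in $f^*L_i$ and $f^*L_j$. Let $\Gamma_i$ and $\Gamma_j$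 be the parts of $\Gamma$ to the left and to the right of $E$, containing $v_i$ and $v_j$ respectively. The determinant of a chain with marks $n_1,\dots,n_k$ is the determinant of the tridiagonal matrix with diagonal entries $n_1,\dots,n_k$ and with $-1$ on the two adjacent diagonals; it is $1$ if $k=0$. A chain $[n_1,\dots,n_k]$ with $k\ge1$, $n_1\ge1$ and $n_2,\dots,n_k\ge2$ corresponds to the HJ (Hirzebruch–Jung) fraction $\frac pq>0$ if $$\frac qp=n_1-\cfrac1{n_2-\cfrac1{n_3-\cdots}}.$$ **Theorem.** For every binary sequence, $w_i$ and $w_j$ are finite and: 1. $\det\Gamma_i=w_i$ and $\det(\Gamma_i-v_i)=w_j$. 2. $\det\Gamma_j=w_j$ and $\det(\Gamma_j-v_j)=w_i$. 3. The chain $\Gamma_i$, read from $v_i$, corresponds to the HJ fraction $\frac{w_j}{w_i}$, and the chain $\Gamma_j$, read from $v_j$, corresponds to the HJ fraction $\frac{w_i}{w_j}$. 4. $(w_i,w_j)$ is the vector reached by the Farey (Stern–Brocot) procedure with the same binary sequence: start with the neighbours $(1,0)$ on the left and $(0,1)$ on the right; for each letter, insert the sum of the two neighbours between them and pass to the left half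 (L) or the right half (R); at the end, take the sum of the two current neighbours. Moreover, every exceptional visible curve, on any surface obtained from $S$ by blowups over $P$ as above, is the final curve $E$ of exactly one binary sequence. The map $E\mapsto(w_i,w_j)$ is a bijection from the set of all exceptional visible curves over $P$ onto the set of pairs of coprime positive integers; equivalently, $E\mapsto\frac{w_j}{w_i}$ is a bijection from this set onto the set of positive rational numbers. -/

import Mathlib

/-! ## Marked chains: determinants and Hirzebruch-Jung continued fractions -/

/-- The matrix of a chain `[n₁, …, n_k]` of curves, `(-E_a.E_b)`: the diagonal entries are the
marks `n_a = -E_a²`, the entries on the two adjacent diagonals are `-1`, all others are `0`. -/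
def chainMatrix (c : List ℤ) : Matrix (Fin c.length) (Fin c.length) ℤ :=
  Matrix.of fun a b =>
    if a = b then c.get a
    else if (a : ℕ) + 1 = (b : ℕ) ∨ (b : ℕ) + 1 = (a : ℕ) then -1
    else 0

/-- The determinant `|n₁, …, n_k|` of a chain; it is `1` for the empty chain. -/
def chainDet (c : List ℤ) : ℤ := (chainMatrix c).det

/-- The continued fraction `n₁ - 1 / (n₂ - 1 / (n₃ - …))`. -/
def hjValue : List ℤ → ℚ
  | [] => 0
  | [n] => (n : ℚ)
  | n :: m :: t => (n : ℚ) - 1 / hjValue (m :: t)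

/-- The chain `c = [n₁, …, n_k]` corresponds to the Hirzebruch-Jung fraction `r = p / q > 0`:
`c` is non-empty, `n₁ ≥ 1`, all other `n_a ≥ 2`, and `q / p = n₁ - 1 / (n₂ - 1 / (n₃ - …))`. -/
def IsHJChain (c : List ℤ) (r : ℚ) : Prop :=
  0 < r ∧ (∃ (n : ℤ) (t : List ℤ), c = n :: t ∧ 1 ≤ n ∧ ∀ m ∈ t, 2 ≤ m) ∧ hjValue c = 1 / r

/-! ## Sequences of blowups, and the marks of the final dual graph -/

/-- The choice made after a blowup with exceptional curve `E`: blow up next the point where `E`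
meets the visible curve to its left (`L`), or the one to its right (`R`). -/
inductive Turn
  | L
  | R

/-- A marked chain of visible curves with a distinguished node (an edge of the chain), which is
the next point to be blown up. `left` lists the marks of the curves to the left of the node,
`right` those to the right of it; *both lists start at the node and go outwards*, so that the
last entry of `left` is the mark of `v_i` and the last entry of `right` is that of `v_j`. -/
structure MarkedEdge where
  left : List ℤ
  right : List ℤ

/-- Before any blowup: the edge `{v_i, v_j}`, with both marks `0`. -/
def MarkedEdge.initial : MarkedEdge := ⟨[0], [0]⟩

/-- The part of the graph left of `E` after blowing up the node: the curve that passed through the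
node loses `1` in self-intersection, i.e. its mark goes up by `1`. -/
def MarkedEdge.leftOfE (g : MarkedEdge) : List ℤ := g.left.modifyHead (· + 1)

/-- The part of the graph right of `E` after blowing up the node. -/
def MarkedEdge.rightOfE (g : MarkedEdge) : List ℤ := g.right.modifyHead (· + 1)

/-- Blow up the distinguished node. The exceptional curve `E` becomes a new vertex, with mark
`1 = -E²`, between the two parts; then choose the node of `E` with its left or right neighbour. -/
def MarkedEdge.step (g : MarkedEdge) : Turn → MarkedEdge
  | Turn.L => ⟨g.leftOfE, 1 :: g.rightOfE⟩
  | Turn.R => ⟨1 :: g.leftOfE, g.rightOfE⟩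

/-- The marked chain before the final blowup of the procedure with the given binary sequence.
The sequence is read from left to right; the empty one means a single blowup at `P`. -/
def markedEdge (s : List Turn) : MarkedEdge := s.foldl MarkedEdge.step MarkedEdge.initial

/-- The chain `Γ_i` to the left of the `(-1)`-curve `E` in the final graph, listed from `v_i`
towards `E`. -/
def gammaI (s : List Turn) : List ℤ := (markedEdge s).leftOfE.reverse

/-- The chain `Γ_j` to the right of the `(-1)`-curve `E` in the final graph, listed from `v_j`
towards `E`. -/
def gammaJ (s : List Turn) : List ℤ := (markedEdge s).rightOfE.reverse

/-! ## The Farey (Stern-Brocot) procedure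

Start from the pair of vectors `(1, 0)`, `(0, 1)`; insert the sum (mediant) of the two vectors
between them, and continue with the left or with the right half. -/

/-- Two neighbouring vectors of the Farey procedure. -/
structure FareyPair where
  left : ℕ × ℕ
  right : ℕ × ℕ

/-- The vector inserted between two neighbours. -/
def FareyPair.mediant (q : FareyPair) : ℕ × ℕ := q.left + q.right

/-- Go to the left or to the right half. -/
def FareyPair.step (q : FareyPair) : Turn → FareyPair
  | Turn.L => ⟨q.left, q.mediant⟩
  | Turn.R => ⟨q.mediant, q.right⟩

/-- The vector that the Farey procedure reaches with the given binary sequence. -/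
def fareyVector (s : List Turn) : ℕ × ℕ :=
  (s.foldl FareyPair.step ⟨(1, 0), (0, 1)⟩).mediant

/-! ## The geometry of the blowups

`R` is the local ring `𝒪_{S,P}` of a smooth surface `S` at the point `P`, and `K` is the function
field of `S`. Points of surfaces obtained from `S` by blowups over `P`, and curves on them, are
represented by their local rings, which are subrings of `K` containing `R`. -/

section Geometry

variable {R : Type*} [CommRing R] {K : Type*} [Field K] [Algebra R K]

/-- The localization, inside `K`, of a subring `A` at the prime ideal generated by those elements
of `T` that lie in `A`: the subring generated by `A` and the inverses of all elements of `A`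
outside that ideal. -/
def localizeAt (A : Subalgebra R K) (T : Set K) : Subalgebra R K :=
  Algebra.adjoin R
    ((A : Set K) ∪
      {z | ∃ b : A, b ∉ Ideal.span {a : A | (a : K) ∈ T} ∧ z = (b : K)⁻¹})

variable (R K) in
/-- A node, i.e. a point where two visible curves cross: the local ring of the surface at this
point, and local equations `u` and `v` of the left and of the right one of the two curves. -/
structure Node where
  ring : Subalgebra R K
  u : K
  v : K

/-- The node `P` itself, where `L_i = {x = 0}` and `L_j = {y = 0}` cross. -/
def Node.base (x y : R) : Node R K := ⟨⊥, algebraMap R K x, algebraMap R K y⟩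

/-- The affine chart `O[v/u]` of the blowup of a node with local ring `O`. In it the exceptional
curve `E` is given by `u = 0` and the strict preimage of the right curve by `v/u = 0`. -/
def Node.chartR (N : Node R K) : Subalgebra R K :=
  Algebra.adjoin R ((N.ring : Set K) ∪ {N.v / N.u})

/-- The affine chart `O[u/v]` of the blowup of a node with local ring `O`. In it the exceptional
curve `E` is given by `v = 0` and the strict preimage of the left curve by `u/v = 0`. -/
def Node.chartL (N : Node R K) : Subalgebra R K :=
  Algebra.adjoin R ((N.ring : Set K) ∪ {N.u / N.v})

/-- The two nodes on the exceptional curve `E` of the blowup of a node: the point of `E` on the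
strict preimage of the left curve, and the one on the strict preimage of the right curve. -/
def Node.step (N : Node R K) : Turn → Node R K
  | Turn.L => ⟨localizeAt N.chartL {N.u / N.v, N.v}, N.u / N.v, N.v⟩
  | Turn.R => ⟨localizeAt N.chartR {N.u, N.v / N.u}, N.u, N.v / N.u⟩

/-- The exceptional curve `E` of the blowup of a node, represented by its local ring
`𝒪_{Y,E} ⊆ K`, the localization of the chart `O[v/u]` at its prime ideal `(u)`. -/
def Node.exceptionalCurve (N : Node R K) : Subalgebra R K := localizeAt N.chartR {N.u}

variable (K) in
/-- The `(-1)`-curve `E` after the final blowup of the procedure with the given binary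
sequence. -/
def finalCurve (x y : R) (s : List Turn) : Subalgebra R K :=
  (s.foldl Node.step (Node.base x y : Node R K)).exceptionalCurve

/-- The coefficient of the curve `E` in the full pullback of the curve `{f = 0}`, i.e. the order of
vanishing of `f` in the local ring `𝒪_{Y,E}`. -/
noncomputable def pullbackCoeff (E : Subalgebra R K) (f : R) : ℕ∞ :=
  Ring.ord E (algebraMap R E f)

variable (K) in
/-- `IsBlowup x y nodes curves`: some surface `Y`, obtained from `S` by a finite sequence of blowups
over `P` at nodes (points where two visible curves cross), has `nodes` as its set of nodes over `P`
and `curves` as its set of exceptional visible curves. -/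
inductive IsBlowup (x y : R) : Set (Node R K) → Set (Subalgebra R K) → Prop
  | initial : IsBlowup x y {Node.base x y} ∅
  | blowup (nodes : Set (Node R K)) (curves : Set (Subalgebra R K)) (N : Node R K) :
      IsBlowup x y nodes curves → N ∈ nodes →
      IsBlowup x y ((nodes \ {N}) ∪ {N.step Turn.L, N.step Turn.R})
        (insert N.exceptionalCurve curves)

variable (K) in
/-- All visible curves lying over `P`, on all blowups. Curves on different blowups are the same if
they are strict preimages of each other, i.e. if they have the same local ring in `K`. -/
def visibleCurves (x y : R) : Set (Subalgebra R K) :=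
  {E | ∃ nodes curves, IsBlowup K x y nodes curves ∧ E ∈ curves}

end Geometry

/-! ## Determinants of chains -/

/-! Chains, curves and Farey vectors are all controlled by one recursion, `fareyCoeffs`. For the
chains, a pair of vectors sits at the ends of the current edge, and `HasChainDets` records four
determinants of each half-chain by the coordinates of this pair. Raising the near mark by 1 adds the
determinant of the tail, and prepending a 1 then subtracts it again; so the chain and the Farey pair
move in step (`markedEdge_matches`). For the curves, `IsParamPair` is a weak form of regularity that
charts and localizations preserve (`IsParamPair.blowup`, `HasParams.step`). On the exceptional curve
`u` is a uniformizer and `v / u` a unit, so a monomial `u ^ m * v ^ n` vanishes to order `m + n`;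
monomials stay monomials at the next node (`pullbackCoeff_foldl`). Finally, Euclid's subtractive
algorithm recovers the sequence from a coprime pair. Since the weights depend only on the local ring
of the curve, different sequences give different curves. -/

theorem chainMatrix_submatrix_succ (n : ℤ) (t : List ℤ) :
    (chainMatrix (n :: t)).submatrix Fin.succ Fin.succ = chainMatrix t := by
  ext a b
  simp [chainMatrix, Fin.succ_inj]

theorem chainDet_nil : chainDet [] = 1 := by
  simp [chainDet]

theorem chainDet_singleton (n : ℤ) : chainDet [n] = n := by
  simp [chainDet, chainMatrix]

/-- Laplace expansion along the first row leaves two terms; the second minor has `M 1 0` as the only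
possibly nonzero entry of its first column. -/
theorem Matrix.det_of_first_row_col_eq_zero {A : Type*} [CommRing A] {n : ℕ}
    (M : Matrix (Fin (n + 2)) (Fin (n + 2)) A) (hrow : ∀ i : Fin n, M 0 i.succ.succ = 0)
    (hcol : ∀ i : Fin n, M i.succ.succ 0 = 0) :
    M.det = M 0 0 * (M.submatrix Fin.succ Fin.succ).det -
      M 0 1 * M 1 0 * (M.submatrix (Fin.succ ∘ Fin.succ) (Fin.succ ∘ Fin.succ)).det := by
  have hminor : (M.submatrix Fin.succ (Fin.succAbove 1)).det
      = M 1 0 * (M.submatrix (Fin.succ ∘ Fin.succ) (Fin.succ ∘ Fin.succ)).det := by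
    rw [Matrix.det_succ_column_zero, Fin.sum_univ_succ, Finset.sum_eq_zero]
    · have e : (M.submatrix Fin.succ (Fin.succAbove 1)).submatrix
          (Fin.succAbove 0) Fin.succ = M.submatrix (Fin.succ ∘ Fin.succ) (Fin.succ ∘ Fin.succ) := by
        ext a b
        simp
      rw [e]
      simp
    · intro i _
      simp [hcol]
  rw [Matrix.det_succ_row_zero, Fin.sum_univ_succ, Fin.sum_univ_succ, Finset.sum_eq_zero]
  · simp only [Fin.succAbove_zero, Fin.val_zero, Fin.succ_zero_eq_one, Fin.val_one, hminor]
    ring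
  · intro i _
    simp [hrow]

theorem chainDet_cons_cons (n m : ℤ) (t : List ℤ) :
    chainDet (n :: m :: t) = n * chainDet (m :: t) - chainDet t := by
  have h := Matrix.det_of_first_row_col_eq_zero (n := t.length) (chainMatrix (n :: m :: t))
    (by intro i; simp [chainMatrix, Fin.ext_iff]) (by intro i; simp [chainMatrix])
  have e1 := chainMatrix_submatrix_succ n (m :: t)
  have e2 : (chainMatrix (n :: m :: t)).submatrix (Fin.succ ∘ Fin.succ) (Fin.succ ∘ Fin.succ) =
      chainMatrix t := by
    ext a b
    simp [chainMatrix, Fin.succ_inj]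
  refine h.trans ?_
  rw [chainDet, chainDet, ← e1, ← e2]
  simp [chainMatrix]

/-- Rows and columns undergo the same permutation. Needed because chains grow at the node but are
finally read from the far end. -/
theorem chainDet_reverse (c : List ℤ) : chainDet c.reverse = chainDet c := by
  have hl : c.length = c.reverse.length := by simp
  have e : chainMatrix c.reverse =
      (chainMatrix c).submatrix ((finCongr hl.symm).trans Fin.revPerm)
        ((finCongr hl.symm).trans Fin.revPerm) := by
    ext a b
    have ha := a.2
    have hb := b.2
    simp only [List.length_reverse] at ha hb
    simp only [chainMatrix, Matrix.of_apply, Matrix.submatrix_apply, EmbeddingLike.apply_eq_iff_eq]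
    congr 1
    · simp [List.getElem_reverse, Fin.val_rev]
      congr 1
      omega
    · simp [Fin.val_rev]
      congr 1
      apply propext
      omega
  rw [chainDet, e, Matrix.det_submatrix_equiv_self, chainDet]

/-- The determinant of a chain without its last vertex, and `0` for the empty chain. -/
def chainDetInit : List ℤ → ℤ
  | [] => 0
  | [_] => 1
  | n :: m :: t => n * chainDetInit (m :: t) - chainDetInit t

/-- Both sides satisfy the same recursion; the value `0` on the empty chain makes it valid already
for two vertices. -/
theorem chainDetInit_eq (c : List ℤ) (hc : c ≠ []) : chainDetInit c = chainDet c.dropLast := by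
  induction c using chainDetInit.induct with
  | case1 => simp at hc
  | case2 n => simp [chainDetInit, chainDet_nil]
  | case3 n m t ih1 ih2 =>
    rw [chainDetInit, ih1 (by simp)]
    cases t with
    | nil => simp [chainDetInit, chainDet_nil, chainDet_singleton]
    | cons p t => rw [ih2 (by simp)]; simp [chainDet_cons_cons]

/-- The determinant is affine in the first mark, with slope the determinant of the rest. -/
theorem chainDet_cons_add_one (n : ℤ) (t : List ℤ) :
    chainDet ((n + 1) :: t) = chainDet (n :: t) + chainDet t := by
  cases t with
  | nil => simp [chainDet_singleton, chainDet_nil]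
  | cons m t => rw [chainDet_cons_cons, chainDet_cons_cons]; ring

theorem chainDetInit_cons_add_one (n : ℤ) (t : List ℤ) :
    chainDetInit ((n + 1) :: t) = chainDetInit (n :: t) + chainDetInit t := by
  cases t with
  | nil => simp [chainDetInit]
  | cons m t => rw [chainDetInit, chainDetInit]; ring

/-! ## Hirzebruch-Jung chains -/

/-- A chain with marks at least `2` behind its first one has positive determinants, and its
continued fraction is the quotient of two of them. -/
theorem hjValue_cons (n : ℤ) (t : List ℤ) (ht : ∀ m ∈ t, 2 ≤ m) :
    0 < chainDet t ∧ (1 ≤ n → 0 < chainDet (n :: t)) ∧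
      hjValue (n :: t) = chainDet (n :: t) / chainDet t := by
  induction t generalizing n with
  | nil =>
    simp only [chainDet_nil, chainDet_singleton, hjValue]
    exact ⟨one_pos, fun h => by omega, by simp⟩
  | cons m t ih =>
    have hm : 2 ≤ m := ht m (by simp)
    have ht' : ∀ k ∈ t, 2 ≤ k := fun k hk => ht k (by simp [hk])
    -- As `m - 1 ≥ 1`, positivity for `(m - 1) :: t` says that `chainDet (m :: t)` exceeds `chainDet
    -- t`; this strict growth gives positivity one vertex further.
    obtain ⟨h0, h1, -⟩ := ih (m - 1) ht'
    obtain ⟨-, -, h3⟩ := ih m ht'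
    have h1 := h1 (by omega)
    have h2 := chainDet_cons_add_one (m - 1) t
    rw [sub_add_cancel] at h2
    refine ⟨by omega, fun hn => ?_, ?_⟩
    · rw [chainDet_cons_cons]
      nlinarith
    · rw [hjValue, h3, chainDet_cons_cons]
      have : (chainDet (m :: t) : ℚ) ≠ 0 := by
        exact_mod_cast (by omega : chainDet (m :: t) ≠ 0)
      push_cast
      field_simp

/-- A chain, listed from its far end, with marks at least `2` except that the near end may have
mark `1`. -/
def IsReversedHJ (c : List ℤ) : Prop := ∃ t n, c = t ++ [n] ∧ 1 ≤ n ∧ ∀ m ∈ t, 2 ≤ m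

theorem IsReversedHJ.modifyHead {c : List ℤ} (h : IsReversedHJ c) :
    IsReversedHJ (c.modifyHead (· + 1)) := by
  obtain ⟨t, n, rfl, hn, ht⟩ := h
  cases t with
  | nil => exact ⟨[], n + 1, by simp, by omega, by simp⟩
  | cons m t =>
    refine ⟨(m + 1) :: t, n, by simp, hn, ?_⟩
    intro k hk
    rcases List.mem_cons.1 hk with rfl | hk
    · have := ht m (by simp)
      omega
    · exact ht k (by simp [hk])

theorem IsReversedHJ.cons_two {c : List ℤ} (h : IsReversedHJ c) : IsReversedHJ (2 :: c) := by
  obtain ⟨t, n, rfl, hn, ht⟩ := h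
  exact ⟨2 :: t, n, by simp, hn, by simpa using ht⟩

theorem IsReversedHJ.isHJChain {c : List ℤ} (h : IsReversedHJ c) :
    IsHJChain c.reverse (chainDet c.reverse.tail / chainDet c.reverse) := by
  obtain ⟨t, n, rfl, hn, ht⟩ := h
  simp only [List.reverse_append, List.reverse_singleton, List.singleton_append, List.tail_cons]
  have ht' : ∀ m ∈ t.reverse, 2 ≤ m := by simpa using ht
  obtain ⟨h0, h1, h2⟩ := hjValue_cons n t.reverse ht'
  have h1 := h1 hn
  refine ⟨by positivity, ⟨n, _, rfl, hn, ht'⟩, ?_⟩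
  rw [h2, one_div_div]

/-! ## The Farey procedure -/

/-- The coefficients of the sum reached by the Farey procedure with respect to the two vectors with
which it starts. -/
def fareyCoeffs : List Turn → ℕ × ℕ
  | [] => (1, 1)
  | Turn.L :: s => ((fareyCoeffs s).1 + (fareyCoeffs s).2, (fareyCoeffs s).2)
  | Turn.R :: s => ((fareyCoeffs s).1, (fareyCoeffs s).1 + (fareyCoeffs s).2)

/-- Each Farey step is linear in the two neighbours, so the coefficients do not depend on the
starting pair, and the first letter can be peeled off. -/
theorem foldl_step_mediant (s : List Turn) (p q : ℕ × ℕ) :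
    (s.foldl FareyPair.step ⟨p, q⟩).mediant =
      (fareyCoeffs s).1 • p + (fareyCoeffs s).2 • q := by
  induction s generalizing p q with
  | nil => simp [fareyCoeffs, FareyPair.mediant]
  | cons a s ih =>
    cases a <;> simp only [List.foldl_cons, FareyPair.step, ih] <;>
      simp only [fareyCoeffs, FareyPair.mediant] <;> module

theorem fareyVector_eq (s : List Turn) : fareyVector s = fareyCoeffs s := by
  rw [fareyVector, foldl_step_mediant]
  ext <;> simp

theorem fareyCoeffs_pos (s : List Turn) : 0 < (fareyCoeffs s).1 ∧ 0 < (fareyCoeffs s).2 := by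
  induction s with
  | nil => simp [fareyCoeffs]
  | cons a s ih => cases a <;> simp only [fareyCoeffs] <;> omega

theorem fareyCoeffs_coprime (s : List Turn) : (fareyCoeffs s).1.Coprime (fareyCoeffs s).2 := by
  induction s with
  | nil => simp [fareyCoeffs]
  | cons a s ih => cases a <;> simpa [fareyCoeffs] using ih

/-- Comparing the two positive coordinates reveals the first letter: equal for the empty sequence,
first larger for `L`, second larger for `R`. Subtraction removes it. -/
theorem fareyCoeffs_injective : Function.Injective fareyCoeffs := by
  intro s
  induction s with
  | nil =>
    rintro (_ | ⟨a, t⟩) h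
    · rfl
    · have := fareyCoeffs_pos t
      cases a <;> simp only [fareyCoeffs, Prod.mk.injEq] at h <;> omega
  | cons a s ih =>
    have hs := fareyCoeffs_pos s
    rintro (_ | ⟨b, t⟩) h
    · cases a <;> simp only [fareyCoeffs, Prod.mk.injEq] at h <;> omega
    · have ht := fareyCoeffs_pos t
      cases a <;> cases b <;> simp only [fareyCoeffs, Prod.mk.injEq] at h
      · rw [@ih t (Prod.ext (by omega) (by omega))]
      · omega
      · omega
      · rw [@ih t (Prod.ext (by omega) (by omega))]

/-- Subtractive Euclidean algorithm: each subtraction records one letter, and coprimality forces it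
to end at `(1, 1)`. -/
theorem exists_fareyCoeffs_eq (a b : ℕ) (ha : 0 < a) (hb : 0 < b) (hab : a.Coprime b) :
    ∃ s, fareyCoeffs s = (a, b) := by
  induction hn : a + b using Nat.strong_induction_on generalizing a b with
  | _ n ih =>
    rcases lt_trichotomy a b with h | rfl | h
    · obtain ⟨s, hs⟩ := ih (a + (b - a)) (by omega) a (b - a) ha (by omega)
        ((Nat.coprime_sub_self_right h.le).2 hab) rfl
      exact ⟨Turn.R :: s, by simp [fareyCoeffs, hs]; omega⟩
    · obtain rfl : a = 1 := by simpa using hab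
      exact ⟨[], rfl⟩
    · obtain ⟨s, hs⟩ := ih ((a - b) + b) (by omega) (a - b) b (by omega) hb
        ((Nat.coprime_sub_self_left h.le).2 hab) rfl
      exact ⟨Turn.L :: s, by simp [fareyCoeffs, hs]; omega⟩

/-! ## The determinants of the chains of a sequence of blowups -/

/-- The part `c` of a marked chain, listed from the node outwards, has determinants given by the
vectors `p` and `q` of the curve at its near end and of the curve on the other side of the node;
the first coordinate belongs to the curve at the far end of `c`. -/
structure HasChainDets (c : List ℤ) (p q : ℤ × ℤ) : Prop where
  ne_nil : c ≠ []
  det : chainDet c = q.1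
  det_tail : chainDet c.tail = p.1
  detInit : chainDetInit c = q.2
  detInit_tail : chainDetInit c.tail = p.2
  -- The near mark must be raised first: it can be 1, or 0 before any blowup.
  isReversedHJ : IsReversedHJ (c.modifyHead (· + 1))

/-- The new curve `E`, with vector `p + q`, now lies across the node, while the near end keeps `p`.
-/
theorem HasChainDets.modifyHead {c : List ℤ} {p q : ℤ × ℤ} (h : HasChainDets c p q) :
    HasChainDets (c.modifyHead (· + 1)) p (p + q) := by
  obtain ⟨h0, h1, h2, h3, h4, h5⟩ := h
  cases c with
  | nil => simp at h0
  | cons n c =>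
    simp only [List.modifyHead_cons, List.tail_cons] at *
    refine ⟨by simp, ?_, h2, ?_, h4, h5.modifyHead⟩
    · rw [chainDet_cons_add_one, h1, h2, Prod.fst_add, add_comm]
    · rw [chainDetInit_cons_add_one, h3, h4, Prod.snd_add, add_comm]

/-- Here `E` becomes the near end and the curve across stays: the determinant is `1 * (p + q) - p =
q` in each coordinate. -/
theorem HasChainDets.cons_one {c : List ℤ} {p q : ℤ × ℤ} (h : HasChainDets c p q) :
    HasChainDets (1 :: c.modifyHead (· + 1)) (p + q) q := by
  have h' := h.modifyHead
  have h5 := h.isReversedHJ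
  generalize c.modifyHead (· + 1) = d at h' h5
  obtain ⟨h0, h1, h2, h3, h4, -⟩ := h'
  cases d with
  | nil => simp at h0
  | cons n d =>
    simp only [List.tail_cons] at h2 h4
    refine ⟨by simp, ?_, h1, ?_, h3, h5.cons_two⟩
    · rw [chainDet_cons_cons, h1, h2]; simp
    · rw [chainDetInit, h3, h4]; simp

/-- The chains of a marked edge have the determinants given by the Farey vectors of its ends. -/
def MarkedEdge.Matches (g : MarkedEdge) (f : FareyPair) : Prop :=
  HasChainDets g.left (f.left.1, f.left.2) (f.right.1, f.right.2) ∧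
    HasChainDets g.right (f.right.2, f.right.1) (f.left.2, f.left.1)

theorem MarkedEdge.Matches.step {g : MarkedEdge} {f : FareyPair} (h : g.Matches f) (t : Turn) :
    (g.step t).Matches (f.step t) := by
  obtain ⟨hl, hr⟩ := h
  cases t
  · refine ⟨?_, ?_⟩
    · simpa [MarkedEdge.step, MarkedEdge.leftOfE, MarkedEdge.rightOfE,
        FareyPair.step, FareyPair.mediant] using hl.modifyHead
    · simpa [MarkedEdge.step, MarkedEdge.leftOfE, MarkedEdge.rightOfE,
        FareyPair.step, FareyPair.mediant, add_comm] using hr.cons_one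
  · refine ⟨?_, ?_⟩
    · simpa [MarkedEdge.step, MarkedEdge.leftOfE, MarkedEdge.rightOfE,
        FareyPair.step, FareyPair.mediant] using hl.cons_one
    · simpa [MarkedEdge.step, MarkedEdge.leftOfE, MarkedEdge.rightOfE,
        FareyPair.step, FareyPair.mediant, add_comm] using hr.modifyHead

theorem MarkedEdge.Matches.foldl {g : MarkedEdge} {f : FareyPair} (h : g.Matches f)
    (s : List Turn) : (s.foldl MarkedEdge.step g).Matches (s.foldl FareyPair.step f) := by
  induction s generalizing g f with
  | nil => exact h
  | cons t s ih => exact ih (h.step t)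

theorem markedEdge_matches (s : List Turn) :
    (markedEdge s).Matches (s.foldl FareyPair.step ⟨(1, 0), (0, 1)⟩) := by
  -- One claim serves both sides, since the right half uses swapped coordinates.
  have h : ∀ p q : ℤ × ℤ, p = (1, 0) → q = (0, 1) → HasChainDets [0] p q := by
    rintro _ _ rfl rfl
    exact ⟨by simp, by simp [chainDet_singleton], by simp [chainDet_nil], rfl, rfl,
      ⟨[], 1, rfl, le_rfl, by simp⟩⟩
  exact MarkedEdge.Matches.foldl ⟨h _ _ rfl rfl, h _ _ rfl rfl⟩ s

theorem HasChainDets.reverse {c : List ℤ} {p q : ℤ × ℤ} (h : HasChainDets c p q) :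
    chainDet (c.modifyHead (· + 1)).reverse = (p + q).1 ∧
      chainDet (c.modifyHead (· + 1)).reverse.tail = (p + q).2 ∧
      IsHJChain (c.modifyHead (· + 1)).reverse ((p + q).2 / (p + q).1) := by
  have h' := h.modifyHead
  have h1 : chainDet (c.modifyHead (· + 1)).reverse = (p + q).1 := by
    rw [chainDet_reverse, h'.det]
  have h2 : chainDet (c.modifyHead (· + 1)).reverse.tail = (p + q).2 := by
    rw [List.tail_reverse, chainDet_reverse, ← chainDetInit_eq _ h'.ne_nil, h'.detInit]
  have h3 := h.isReversedHJ.isHJChain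
  rw [h1, h2] at h3
  exact ⟨h1, h2, h3⟩

theorem gamma_spec (s : List Turn) :
    chainDet (gammaI s) = (fareyVector s).1 ∧ chainDet (gammaI s).tail = (fareyVector s).2 ∧
    chainDet (gammaJ s) = (fareyVector s).2 ∧ chainDet (gammaJ s).tail = (fareyVector s).1 ∧
    IsHJChain (gammaI s) (((fareyVector s).2 : ℚ) / (fareyVector s).1) ∧
    IsHJChain (gammaJ s) (((fareyVector s).1 : ℚ) / (fareyVector s).2) := by
  obtain ⟨hl, hr⟩ := markedEdge_matches s
  obtain ⟨h1, h2, h3⟩ := hl.reverse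
  obtain ⟨h4, h5, h6⟩ := hr.reverse
  rw [add_comm] at h4 h5 h6
  refine ⟨?_, ?_, ?_, ?_, ?_, ?_⟩
  · simpa [fareyVector, FareyPair.mediant, gammaI, MarkedEdge.leftOfE] using h1
  · simpa [fareyVector, FareyPair.mediant, gammaI, MarkedEdge.leftOfE] using h2
  · simpa [fareyVector, FareyPair.mediant, gammaJ, MarkedEdge.rightOfE] using h4
  · simpa [fareyVector, FareyPair.mediant, gammaJ, MarkedEdge.rightOfE] using h5
  · simpa [fareyVector, FareyPair.mediant, gammaI, MarkedEdge.leftOfE] using h3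
  · simpa [fareyVector, FareyPair.mediant, gammaJ, MarkedEdge.rightOfE] using h6

/-! ## Pairs of parameters -/

/-- `u` and `v` are nonzero, generate a prime ideal, and `v` is a nonzerodivisor modulo `u`. -/
structure IsParamPair {A : Type*} [CommRing A] (u v : A) : Prop where
  left_ne_zero : u ≠ 0
  right_ne_zero : v ≠ 0
  isPrime : (Ideal.span {u, v}).IsPrime
  dvd_of_dvd_mul : ∀ a, u ∣ v * a → u ∣ a

theorem isPrime_of_comap_of_surjective {A B : Type*} [CommRing A] [CommRing B] {φ : A →+* B}
    (hφ : Function.Surjective φ) {I : Ideal B} (h : (I.comap φ).IsPrime) : I.IsPrime := by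
  rw [← Ideal.map_comap_of_surjective φ hφ I]
  exact Ideal.map_isPrime_of_surjective hφ (Ideal.comap_mono bot_le)

namespace IsParamPair

section

variable {A : Type*} [CommRing A] {u v : A}

theorem symm [IsDomain A] (h : IsParamPair u v) : IsParamPair v u := by
  refine ⟨h.right_ne_zero, h.left_ne_zero, by rw [Set.pair_comm]; exact h.isPrime, ?_⟩
  rintro a ⟨b, hb⟩
  obtain ⟨c, rfl⟩ := h.dvd_of_dvd_mul b ⟨a, hb.symm⟩
  refine ⟨c, mul_left_cancel₀ h.left_ne_zero ?_⟩
  rw [hb]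
  ring

theorem dvd_of_dvd_pow_mul (h : IsParamPair u v) (n : ℕ) (a : A) (ha : u ∣ v ^ n * a) : u ∣ a := by
  induction n with
  | zero => simpa using ha
  | succ n ih => exact ih (h.dvd_of_dvd_mul _ (by rwa [← mul_assoc, ← pow_succ']))

theorem map_ringEquiv {B : Type*} [CommRing B] (e : A ≃+* B) (h : IsParamPair u v) :
    IsParamPair (e u) (e v) := by
  refine ⟨by simpa using h.left_ne_zero, by simpa using h.right_ne_zero, ?_, ?_⟩
  · have : Ideal.span {e u, e v} = (Ideal.span {u, v}).map (e : A →+* B) := by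
      rw [Ideal.map_span, Set.image_pair]; rfl
    rw [this]
    have := h.isPrime
    exact Ideal.map_isPrime_of_equiv e
  · intro a ha
    have := map_dvd e.symm ha
    simp only [map_mul, RingEquiv.symm_apply_apply] at this
    simpa using map_dvd e (h.dvd_of_dvd_mul _ this)

theorem localization [IsDomain A] {B : Type*} [CommRing B] [Algebra A B] {P : Ideal A} [P.IsPrime]
    [IsLocalization.AtPrime B P] (hP : P = Ideal.span {u, v}) (h : IsParamPair u v) :
    IsParamPair (algebraMap A B u) (algebraMap A B v) := by
  have hinj : Function.Injective (algebraMap A B) :=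
    IsLocalization.injective B P.primeCompl_le_nonZeroDivisors
  have hloc : IsLocalRing B := IsLocalization.AtPrime.isLocalRing B P
  refine ⟨by simpa using hinj.ne h.left_ne_zero, by simpa using hinj.ne h.right_ne_zero, ?_, ?_⟩
  · have : Ideal.span {algebraMap A B u, algebraMap A B v} = P.map (algebraMap A B) := by
      rw [hP, Ideal.map_span, Set.image_pair]
    rw [this, IsLocalization.AtPrime.map_eq_maximalIdeal P B]
    infer_instance
  · intro a ha
    obtain ⟨⟨a', s⟩, hs⟩ := IsLocalization.surj P.primeCompl a
    have hmap : ∀ b, algebraMap A B u ∣ b ↔ b ∈ (Ideal.span {u}).map (algebraMap A B) := by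
      intro b
      rw [Ideal.map_span, Set.image_singleton, Ideal.mem_span_singleton]
    have h1 : algebraMap A B u ∣ algebraMap A B (v * a') := by
      rw [map_mul, ← hs, ← mul_assoc]
      exact ha.mul_right _
    -- Back in `A`, divisibility holds up to a factor `m` outside `P`; `v` is cancelled in front of
    -- `m * a'`, and `m` is a unit in `B`.
    rw [hmap, IsLocalization.algebraMap_mem_map_algebraMap_iff P.primeCompl] at h1
    obtain ⟨m, hm, h1⟩ := h1
    rw [Ideal.mem_span_singleton, mul_left_comm] at h1
    have h2 := map_dvd (algebraMap A B) (h.dvd_of_dvd_mul _ h1)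
    have hmu : IsUnit (algebraMap A B m) := IsLocalization.map_units B (⟨m, hm⟩ : P.primeCompl)
    rw [map_mul, hmu.dvd_mul_left, ← hs, (IsLocalization.map_units B s).dvd_mul_right] at h2
    exact h2

end

/-! ### Charts of a blowup as quotients of a polynomial ring -/

open Polynomial

section

variable {O : Type*} [CommRing O] {u v : O}

/-- The relations of degree zero between `u` and `v` have coefficients in `(u, v)`. -/
theorem mem_map_C_of_aeval_eq_zero {K : Type*} [Field K] [Algebra O K] [FaithfulSMul O K]
    (h : IsParamPair u v) (f : O[X])
    (hf : aeval (algebraMap O K v / algebraMap O K u) f = 0) :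
    f ∈ (Ideal.span {u, v}).map C := by
  have hu0 : algebraMap O K u ≠ 0 := by simpa using h.left_ne_zero
  have hinj := FaithfulSMul.algebraMap_injective O K
  obtain ⟨n, hn⟩ : ∃ n, f.natDegree ≤ n := ⟨_, le_rfl⟩
  induction n generalizing f with
  | zero =>
    rw [eq_C_of_natDegree_le_zero hn] at hf ⊢
    rw [aeval_C] at hf
    have := (map_eq_zero_iff _ hinj).1 hf
    rw [this]
    simp
  | succ n ih =>
    -- Multiply the relation by `u ^ (n + 1)`: every term but the top one keeps a factor `u`, so `u`
    -- divides `v ^ (n + 1)` times the top coefficient.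
    have hu : u ∣ f.coeff (n + 1) := by
      refine h.dvd_of_dvd_pow_mul (n + 1) _
        ⟨-∑ i ∈ Finset.range (n + 1), f.coeff i * u ^ (n - i) * v ^ i, hinj ?_⟩
      rw [aeval_eq_sum_range' (Nat.lt_succ_of_le hn), Finset.sum_range_succ] at hf
      have hf' := congrArg (algebraMap O K u ^ (n + 1) * ·) hf
      simp only [mul_add, mul_zero, Finset.mul_sum, Algebra.smul_def, div_pow] at hf'
      simp only [map_mul, map_neg, map_sum, map_pow, mul_neg, Finset.mul_sum]
      rw [eq_neg_iff_add_eq_zero, ← hf', add_comm]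
      congr 1
      · refine Finset.sum_congr rfl fun i hi => ?_
        have : n + 1 = (n - i) + 1 + i := by
          have := Finset.mem_range.1 hi
          omega
        rw [this, pow_add, pow_succ]
        field_simp
      · field_simp
    obtain ⟨k, hk⟩ := hu
    -- The subtracted multiple of `u X - v` vanishes at `v / u`, has coefficients in `(u, v)` and
    -- cancels the top term.
    have hlt := ih (f - C k * X ^ n * (C u * X - C v)) ?_ ?_
    · rw [← sub_add_cancel f (C k * X ^ n * (C u * X - C v))]
      refine Ideal.add_mem _ hlt (Ideal.mul_mem_left _ _ (Ideal.sub_mem _ ?_ ?_))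
      · exact Ideal.mul_mem_right _ _ (Ideal.mem_map_of_mem _ (Ideal.subset_span (by simp)))
      · exact Ideal.mem_map_of_mem _ (Ideal.subset_span (by simp))
    · rw [map_sub, hf]
      simp only [map_mul, map_sub, aeval_C, aeval_X, zero_sub]
      field_simp
      simp
    · have e : C k * X ^ n * (C u * X - C v) = C (k * u) * X ^ (n + 1) - C (k * v) * X ^ n := by
        simp only [C_mul]
        ring
      rw [natDegree_le_iff_coeff_eq_zero, e]
      intro N hN
      simp only [coeff_sub, coeff_C_mul_X_pow]
      rcases (Nat.succ_le_of_lt hN).eq_or_lt with rfl | hN'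
      · simp [hk, mul_comm]
      · rw [coeff_eq_zero_of_natDegree_lt (by omega)]
        simp [hN'.ne', (show N ≠ n by omega)]

variable {A : Type*} [CommRing A] {φ : O[X] →+* A}

/-- Modulo `u` the chart becomes the polynomial ring over `O / (u, v)`: the exceptional curve is an
affine line over it. -/
theorem comap_span_singleton (hφ : Function.Surjective φ)
    (hker : RingHom.ker φ ≤ (Ideal.span {u, v}).map C) (hv : φ (C v) = φ (C u) * φ X) :
    (Ideal.span {φ (C u)}).comap φ = (Ideal.span {u, v}).map C := by
  apply le_antisymm
  · intro f hf
    obtain ⟨a, ha⟩ := Ideal.mem_span_singleton.1 (Ideal.mem_comap.1 hf)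
    obtain ⟨g, rfl⟩ := hφ a
    rw [← sub_add_cancel f (C u * g)]
    refine Ideal.add_mem _ (hker ?_) (Ideal.mul_mem_right _ _
      (Ideal.mem_map_of_mem _ (Ideal.subset_span (by simp))))
    simp [RingHom.mem_ker, ha]
  · rw [Ideal.map_span, Set.image_pair, Ideal.span_le]
    rintro _ (rfl | rfl)
    · exact Ideal.mem_span_singleton_self _
    · exact Ideal.mem_span_singleton.2 ⟨_, hv⟩

/-- The origin of that line: once `X` is killed too, only the constant term modulo `(u, v)` matters.
-/
theorem comap_span_pair (hφ : Function.Surjective φ)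
    (hker : RingHom.ker φ ≤ (Ideal.span {u, v}).map C) (hv : φ (C v) = φ (C u) * φ X) :
    (Ideal.span {φ (C u), φ X}).comap φ = (Ideal.span {u, v}).comap constantCoeff := by
  ext f
  rw [Ideal.mem_comap, Ideal.mem_comap, constantCoeff_apply]
  constructor
  · intro hf
    obtain ⟨a, b, hab⟩ := Ideal.mem_span_pair.1 hf
    obtain ⟨a, rfl⟩ := hφ a
    obtain ⟨b, rfl⟩ := hφ b
    have h1 : f - (a * C u + b * X) ∈ (Ideal.span {u, v}).map C :=
      hker (by simp [RingHom.mem_ker, hab])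
    have h2 := Ideal.mem_map_C_iff.1 h1 0
    simp only [coeff_sub, coeff_add, mul_coeff_zero, coeff_C_zero, coeff_X_zero, mul_zero,
      add_zero] at h2
    rw [← sub_add_cancel (f.coeff 0) (a.coeff 0 * u)]
    exact Ideal.add_mem _ h2 (Ideal.mul_mem_left _ _ (Ideal.subset_span (by simp)))
  · intro hf
    rw [← divX_mul_X_add f, map_add, map_mul]
    refine Ideal.add_mem _ (Ideal.mul_mem_left _ _ (Ideal.subset_span (by simp))) ?_
    have h1 : C (f.coeff 0) ∈ (Ideal.span {φ (C u)}).comap φ := by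
      rw [comap_span_singleton hφ hker hv]
      exact Ideal.mem_map_of_mem _ hf
    exact Ideal.span_mono (by simp) (Ideal.mem_comap.1 h1)

theorem isPrime_span_singleton (h : IsParamPair u v) (hφ : Function.Surjective φ)
    (hker : RingHom.ker φ ≤ (Ideal.span {u, v}).map C) (hv : φ (C v) = φ (C u) * φ X) :
    (Ideal.span {φ (C u)}).IsPrime := by
  refine isPrime_of_comap_of_surjective hφ ?_
  rw [comap_span_singleton hφ hker hv]
  have := h.isPrime
  exact Ideal.isPrime_map_C_of_isPrime

theorem not_dvd (h : IsParamPair u v) (hφ : Function.Surjective φ)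
    (hker : RingHom.ker φ ≤ (Ideal.span {u, v}).map C) (hv : φ (C v) = φ (C u) * φ X) :
    ¬ φ (C u) ∣ φ X := by
  intro hd
  have : X ∈ (Ideal.span {φ (C u)}).comap φ := Ideal.mem_span_singleton.2 hd
  rw [comap_span_singleton hφ hker hv, Ideal.mem_map_C_iff] at this
  exact h.isPrime.ne_top ((Ideal.eq_top_iff_one _).2 (by simpa using this 1))

/-- The ideal of the exceptional curve is prime and does not contain `φ X`, hence `φ X` can be
cancelled modulo it. -/
theorem blowup (h : IsParamPair u v) (hφ : Function.Surjective φ)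
    (hker : RingHom.ker φ ≤ (Ideal.span {u, v}).map C) (hv : φ (C v) = φ (C u) * φ X)
    (hu : φ (C u) ≠ 0) : IsParamPair (φ (C u)) (φ X) := by
  have hX := h.not_dvd hφ hker hv
  refine ⟨hu, fun h0 => hX (by simp [h0]), ?_, fun a ha => ?_⟩
  · refine isPrime_of_comap_of_surjective hφ ?_
    rw [comap_span_pair hφ hker hv]
    have := h.isPrime
    exact Ideal.comap_isPrime _ _
  · have hp := h.isPrime_span_singleton hφ hker hv
    rw [Ideal.span_singleton_prime hu] at hp
    exact (hp.dvd_or_dvd ha).resolve_left hX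

end

end IsParamPair

/-! ## Regular local rings of dimension two -/

/-- Otherwise every prime containing `x` contains `y`, so the maximal ideal is minimal over `(x)`
and has height at most 1 by Krull's principal ideal theorem. -/
theorem IsRegularLocalRing.not_pow_mem_span {R : Type*} [CommRing R] [IsRegularLocalRing R]
    (hdim : ringKrullDim R = 2) {x y : R} (hxy : IsLocalRing.maximalIdeal R = Ideal.span {x, y})
    (n : ℕ) : ¬ x ∣ y ^ n := by
  intro hd
  have hx : x ∈ IsLocalRing.maximalIdeal R := hxy ▸ Ideal.subset_span (by simp)
  have hmin : IsLocalRing.maximalIdeal R ∈ (Ideal.span {x}).minimalPrimes := by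
    refine ⟨⟨inferInstance, by simpa [Ideal.span_le] using hx⟩, ?_⟩
    rintro q ⟨hq, hxq⟩ -
    rw [Ideal.span_singleton_le_iff_mem] at hxq
    rw [hxy, Ideal.span_le]
    rintro _ (rfl | rfl)
    · exact hxq
    · exact hq.mem_of_pow_mem n (Ideal.mem_of_dvd _ hd hxq)
  have h1 := Ideal.height_le_one_of_isPrincipal_of_mem_minimalPrimes _ _ hmin
  have h2 := IsLocalRing.maximalIdeal_height_eq_ringKrullDim (R := R)
  rw [hdim] at h2
  have h3 : (IsLocalRing.maximalIdeal R).height = 2 := WithBot.coe_injective h2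
  rw [h3] at h1
  exact absurd h1 (by decide)

theorem IsRegularLocalRing.isParamPair {R : Type*} [CommRing R] [IsRegularLocalRing R]
    (hdim : ringKrullDim R = 2) {x y : R} (hxy : IsLocalRing.maximalIdeal R = Ideal.span {x, y}) :
    IsParamPair x y := by
  have hyx : IsLocalRing.maximalIdeal R = Ideal.span {y, x} := by rw [hxy, Set.pair_comm]
  have hpow := IsRegularLocalRing.not_pow_mem_span hdim hxy
  refine ⟨?_, ?_, hxy ▸ inferInstance, fun a ha => ?_⟩
  · rintro rfl
    exact IsRegularLocalRing.not_pow_mem_span hdim hyx 1 (by simp)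
  · rintro rfl
    exact hpow 1 (by simp)
  -- Modulo `x`, the element `a` is divisible by every power of `y`: the cofactor `c` is never a
  -- unit, as `x` divides no power of `y`, so it lies in `(x, y)` and yields one more `y`.
  · have key : ∀ n, ∃ c d, a = y ^ n * c + x * d := by
      intro n
      induction n with
      | zero => exact ⟨a, 0, by simp⟩
      | succ n ih =>
        obtain ⟨c, d, hcd⟩ := ih
        have h1 : x ∣ y ^ (n + 1) * c := by
          have : y ^ (n + 1) * c = y * a - x * (y * d) := by rw [hcd]; ring
          rw [this]
          exact dvd_sub ha (dvd_mul_right _ _)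
        have hc : c ∈ Ideal.span {x, y} := by
          rw [← hxy, IsLocalRing.mem_maximalIdeal]
          intro hu
          exact hpow (n + 1) (hu.dvd_mul_right.1 h1)
        obtain ⟨p, q, rfl⟩ := Ideal.mem_span_pair.1 hc
        exact ⟨q, y ^ n * p + d, by rw [hcd]; ring⟩
    have hx : x ∈ IsLocalRing.maximalIdeal R := hxy ▸ Ideal.subset_span (by simp)
    have hy : y ∈ IsLocalRing.maximalIdeal R := hxy ▸ Ideal.subset_span (by simp)
    have hne : Ideal.span {x} ≠ ⊤ := by
      rw [Ne, Ideal.span_singleton_eq_top]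
      exact (IsLocalRing.mem_maximalIdeal _).1 hx
    have : Nontrivial (R ⧸ Ideal.span {x}) := Ideal.Quotient.nontrivial_iff.2 hne
    have : IsLocalRing (R ⧸ Ideal.span {x}) :=
      IsLocalRing.of_surjective' (Ideal.Quotient.mk _) Ideal.Quotient.mk_surjective
    have hnt : Ideal.span {Ideal.Quotient.mk (Ideal.span {x}) y} ≠ ⊤ := by
      rw [Ne, Ideal.span_singleton_eq_top]
      intro hu
      obtain ⟨b, hb⟩ := isUnit_iff_exists_inv.1 hu
      obtain ⟨b, rfl⟩ := Ideal.Quotient.mk_surjective b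
      rw [← map_mul, ← map_one (Ideal.Quotient.mk _), Ideal.Quotient.eq,
        Ideal.mem_span_singleton] at hb
      refine (Ideal.ne_top_iff_one _).1 (IsLocalRing.maximalIdeal.isMaximal R).ne_top ?_
      rw [← sub_sub_cancel (y * b) 1]
      exact Ideal.sub_mem _ (Ideal.mul_mem_right _ _ hy) (Ideal.mem_of_dvd _ hb hx)
    -- Krull's intersection theorem in `R / (x)` now forces `a` to vanish there.
    have hinf := Ideal.iInf_pow_eq_bot_of_isLocalRing _ hnt
    rw [← Ideal.mem_span_singleton, ← Ideal.Quotient.eq_zero_iff_mem, ← Ideal.mem_bot, ← hinf,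
      Ideal.mem_iInf]
    intro n
    obtain ⟨c, d, hcd⟩ := key n
    rw [Ideal.span_singleton_pow, Ideal.mem_span_singleton, hcd]
    refine ⟨Ideal.Quotient.mk _ c, ?_⟩
    have : Ideal.Quotient.mk (Ideal.span {x}) x = 0 :=
      Ideal.Quotient.eq_zero_iff_mem.2 (Ideal.mem_span_singleton_self x)
    simp [this]

section BlowupGeometry

variable {R : Type*} [CommRing R] {K : Type*} [Field K] [Algebra R K]

/-! ## Localizations inside the function field -/

theorem le_localizeAt (A : Subalgebra R K) (T : Set K) : A ≤ localizeAt A T :=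
  fun _ hz => Algebra.subset_adjoin (Or.inl hz)

theorem exists_mul_eq_of_mem_localizeAt {A : Subalgebra R K} {T : Set K}
    (hP : (Ideal.span {a : A | (a : K) ∈ T}).IsPrime) {z : K} (hz : z ∈ localizeAt A T) :
    ∃ a b : A, b ∉ Ideal.span {a : A | (a : K) ∈ T} ∧ z * b = a := by
  have h1 : (1 : A) ∉ Ideal.span {a : A | (a : K) ∈ T} := (Ideal.ne_top_iff_one _).1 hP.ne_top
  induction hz using Algebra.adjoin_induction with
  | mem z hz =>
    rcases hz with hz | ⟨b, hb, rfl⟩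
    · exact ⟨⟨z, hz⟩, 1, h1, by simp⟩
    · refine ⟨1, b, hb, ?_⟩
      have : (b : K) ≠ 0 := fun h => hb (by
        have : b = 0 := Subtype.ext h
        rw [this]
        exact Ideal.zero_mem _)
      simp [this]
  | algebraMap r => exact ⟨algebraMap R A r, 1, h1, by simp⟩
  | add z w _ _ hz hw =>
    obtain ⟨a, b, hb, hab⟩ := hz
    obtain ⟨c, d, hd, hcd⟩ := hw
    refine ⟨a * d + c * b, b * d, hP.mul_notMem hb hd, ?_⟩
    push_cast
    rw [← hab, ← hcd]
    ring
  | mul z w _ _ hz hw =>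
    obtain ⟨a, b, hb, hab⟩ := hz
    obtain ⟨c, d, hd, hcd⟩ := hw
    refine ⟨a * c, b * d, hP.mul_notMem hb hd, ?_⟩
    push_cast
    rw [← hab, ← hcd]
    ring

/-- `localizeAt A T` as an algebra over `A`. -/
@[reducible]
def localizeAtAlgebra (A : Subalgebra R K) (T : Set K) : Algebra A (localizeAt A T) :=
  (Subalgebra.inclusion (le_localizeAt A T)).toRingHom.toAlgebra

/-- Sums and products of fractions with denominators outside `P` are again such fractions, so
adjoining the inverses adds nothing else. -/
theorem localizeAt_isLocalization (A : Subalgebra R K) (T : Set K) (P : Ideal A) [hP : P.IsPrime]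
    (hT : Ideal.span {a : A | (a : K) ∈ T} = P) :
    letI := localizeAtAlgebra A T
    IsLocalization.AtPrime (localizeAt A T) P := by
  subst hT
  let := localizeAtAlgebra A T
  have hmap : ∀ a : A, ((algebraMap A (localizeAt A T) a : localizeAt A T) : K) = a := fun _ => rfl
  have hinj : Function.Injective (algebraMap A (localizeAt A T)) := fun a b h =>
    Subtype.ext (by rw [← hmap, ← hmap, h])
  refine ⟨?_, ?_, ?_⟩
  · rintro ⟨b, hb⟩
    have hb0 : (b : K) ≠ 0 := fun h => hb (by
      have : b = 0 := Subtype.ext h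
      rw [this]
      exact Ideal.zero_mem _)
    refine isUnit_iff_exists_inv.2 ⟨⟨(b : K)⁻¹, Algebra.subset_adjoin (Or.inr ⟨b, hb, rfl⟩)⟩, ?_⟩
    exact Subtype.ext (mul_inv_cancel₀ hb0)
  · rintro ⟨z, hz⟩
    obtain ⟨a, b, hb, hab⟩ := exists_mul_eq_of_mem_localizeAt hP hz
    exact ⟨(a, ⟨b, hb⟩), Subtype.ext hab⟩
  · intro a b h
    exact ⟨1, by rw [hinj h]⟩

theorem setOf_coe_mem_pair {A : Subalgebra R K} (a b : A) :
    {c : A | (c : K) ∈ ({(a : K), (b : K)} : Set K)} = {a, b} := by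
  ext c
  simp only [Set.mem_ofPred_eq, Set.mem_insert_iff, Set.mem_singleton_iff, SetLike.coe_eq_coe]

theorem setOf_coe_mem_singleton {A : Subalgebra R K} (a : A) :
    {c : A | (c : K) ∈ ({(a : K)} : Set K)} = {a} := by
  ext c
  simp only [Set.mem_ofPred_eq, Set.mem_singleton_iff, SetLike.coe_eq_coe]

/-- The local ring `O` contains `u` and `v`, and these elements are parameters of it. -/
def HasParams (O : Subalgebra R K) (u v : K) : Prop :=
  ∃ u' v' : O, (u' : K) = u ∧ (v' : K) = v ∧ IsParamPair u' v'

theorem HasParams.symm {O : Subalgebra R K} {u v : K} (h : HasParams O u v) : HasParams O v u := by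
  obtain ⟨u', v', hu, hv, h⟩ := h
  exact ⟨v', u', hv, hu, h.symm⟩

theorem HasParams.at_localization {O : Subalgebra R K} {u v : K} (h : HasParams O u v) :
    HasParams (localizeAt O {u, v}) u v := by
  obtain ⟨u, v, rfl, rfl, h⟩ := h
  let := localizeAtAlgebra O {(u : K), (v : K)}
  have := h.isPrime
  have := localizeAt_isLocalization O {(u : K), (v : K)} (Ideal.span {u, v})
    (by rw [setOf_coe_mem_pair])
  exact ⟨_, _, rfl, rfl, h.localization (B := localizeAt O {(u : K), (v : K)}) rfl⟩

/-! ## Charts of a blowup -/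

open Polynomial

/-- The affine chart `O[t]` of a blowup. -/
def blowupChart (O : Subalgebra R K) (t : K) : Subalgebra R K :=
  Algebra.adjoin R ((O : Set K) ∪ {t})

theorem aeval_mem_blowupChart (O : Subalgebra R K) (t : K) (f : O[X]) :
    aeval t f ∈ blowupChart O t := by
  rw [aeval_eq_sum_range]
  have ht : t ∈ blowupChart O t := Algebra.subset_adjoin (Or.inr rfl)
  have hO : O ≤ blowupChart O t := fun z hz => Algebra.subset_adjoin (Or.inl hz)
  exact Subalgebra.sum_mem _ fun i _ =>
    Subalgebra.mul_mem _ (hO (f.coeff i).2) (Subalgebra.pow_mem _ ht _)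

/-- The presentation of the chart `O[t]` as a quotient of the polynomial ring. -/
noncomputable def blowupChartHom (O : Subalgebra R K) (t : K) : O[X] →+* blowupChart O t :=
  (aeval t : O[X] →ₐ[O] K).toRingHom.codRestrict (blowupChart O t) (aeval_mem_blowupChart O t)

theorem coe_blowupChartHom (O : Subalgebra R K) (t : K) (f : O[X]) :
    (blowupChartHom O t f : K) = aeval t f := rfl

theorem blowupChartHom_surjective (O : Subalgebra R K) (t : K) :
    Function.Surjective (blowupChartHom O t) := by
  have h : ∀ z ∈ blowupChart O t, ∃ f : O[X], aeval t f = z := by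
    intro z hz
    induction hz using Algebra.adjoin_induction with
    | mem z hz =>
      rcases hz with hz | rfl
      · exact ⟨C ⟨z, hz⟩, by simp⟩
      · exact ⟨X, by simp⟩
    | algebraMap r => exact ⟨C (algebraMap R O r), by simp⟩
    | add z w _ _ hz hw =>
      obtain ⟨f, rfl⟩ := hz
      obtain ⟨g, rfl⟩ := hw
      exact ⟨f + g, by simp⟩
    | mul z w _ _ hz hw =>
      obtain ⟨f, rfl⟩ := hz
      obtain ⟨g, rfl⟩ := hw
      exact ⟨f * g, by simp⟩
  rintro ⟨z, hz⟩
  obtain ⟨f, hf⟩ := h z hz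
  exact ⟨f, Subtype.ext hf⟩

/-- In the chart `O[v / u]` the exceptional curve `u = 0` is prime, the strict preimage
`v / u = 0` does not contain it, and the two cross normally. -/
theorem HasParams.exists_chart_params {O : Subalgebra R K} {u v : K} (h : HasParams O u v) :
    ∃ u' t' : blowupChart O (v / u), (u' : K) = u ∧ (t' : K) = v / u ∧ IsParamPair u' t' ∧
      (Ideal.span {u'}).IsPrime ∧ t' ∉ Ideal.span {u'} := by
  obtain ⟨u, v, rfl, rfl, h⟩ := h
  have hu0 : (u : K) ≠ 0 := fun h0 => h.left_ne_zero (Subtype.ext h0)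
  have hsurj := blowupChartHom_surjective O ((v : K) / u)
  have hker : RingHom.ker (blowupChartHom O ((v : K) / u)) ≤ (Ideal.span {u, v}).map C := by
    intro f hf
    exact h.mem_map_C_of_aeval_eq_zero (K := K) f (congrArg Subtype.val hf)
  have hu : (blowupChartHom O ((v : K) / u) (C u) : K) = u := by
    rw [coe_blowupChartHom, aeval_C]; rfl
  have hX : (blowupChartHom O ((v : K) / u) X : K) = v / u := by
    rw [coe_blowupChartHom, aeval_X]
  have hv : blowupChartHom O ((v : K) / u) (C v) =
      blowupChartHom O ((v : K) / u) (C u) * blowupChartHom O ((v : K) / u) X := by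
    apply Subtype.ext
    rw [MulMemClass.coe_mul, hu, hX, coe_blowupChartHom, aeval_C, mul_div_cancel₀ _ hu0]
    rfl
  refine ⟨_, _, hu, hX, h.blowup hsurj hker hv fun h0 => hu0 ?_,
    h.isPrime_span_singleton hsurj hker hv, ?_⟩
  · rw [← hu, h0]; rfl
  · rw [Ideal.mem_span_singleton]
    exact h.not_dvd hsurj hker hv

theorem HasParams.localize_blowupChart {O : Subalgebra R K} {u v : K} (h : HasParams O u v) :
    HasParams (localizeAt (blowupChart O (v / u)) {u, v / u}) u (v / u) := by
  obtain ⟨u', t', hu, ht, h, -⟩ := h.exists_chart_params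
  exact HasParams.at_localization ⟨u', t', hu, ht, h⟩

theorem HasParams.step {N : Node R K} (h : HasParams N.ring N.u N.v) (t : Turn) :
    HasParams (N.step t).ring (N.step t).u (N.step t).v := by
  cases t
  -- The left chart is the right one with `u` and `v` exchanged.
  · have := h.symm.localize_blowupChart.symm
    rw [Set.pair_comm] at this
    exact this
  · exact h.localize_blowupChart

/-! ## The order of vanishing along the exceptional curve -/

theorem Ring.ord_eq_one_of_isMaximal {A : Type*} [CommRing A] {a : A}
    (h : (Ideal.span {a}).IsMaximal) : Ring.ord A a = 1 := by
  rw [Ring.ord, Module.length_eq_one_iff,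
    isSimpleModule_iff_isSimpleModule_of_algebraMap_surjective (S := A ⧸ Ideal.span {a})
    Ideal.Quotient.mk_surjective]
  let := Ideal.Quotient.field (Ideal.span {a})
  exact instIsSimpleModule _

/-- In the localization `u` generates the maximal ideal, so it has order 1, and `t` is a unit. -/
theorem ord_localizeAt_singleton {A : Subalgebra R K} {u t : A} (hu : u ≠ 0)
    (hP : (Ideal.span {u}).IsPrime) (ht : t ∉ Ideal.span {u})
    (z : localizeAt A {(u : K)}) (m n : ℕ) (hz : (z : K) = u ^ m * t ^ n) :
    Ring.ord (localizeAt A {(u : K)}) z = m := by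
  let := localizeAtAlgebra A {(u : K)}
  have := localizeAt_isLocalization A {(u : K)} (Ideal.span {u}) (by rw [setOf_coe_mem_singleton])
  have hlocal := IsLocalization.AtPrime.isLocalRing (localizeAt A {(u : K)}) (Ideal.span {u})
  have hmax : (Ideal.span {algebraMap A (localizeAt A {(u : K)}) u}).IsMaximal := by
    have h := IsLocalization.AtPrime.map_eq_maximalIdeal (Ideal.span {u}) (localizeAt A {(u : K)})
    rw [Ideal.map_span, Set.image_singleton] at h
    rw [h]
    infer_instance
  have htunit : IsUnit (algebraMap A (localizeAt A {(u : K)}) t) :=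
    IsLocalization.map_units _ (⟨t, ht⟩ : (Ideal.span {u}).primeCompl)
  have hu0 : algebraMap A (localizeAt A {(u : K)}) u ∈ nonZeroDivisors _ :=
    mem_nonZeroDivisors_of_ne_zero fun h0 => hu (Subtype.ext
      (congrArg (fun w : localizeAt A {(u : K)} => (w : K)) h0))
  obtain rfl : z = algebraMap A _ u ^ m * algebraMap A _ t ^ n := Subtype.ext hz
  rw [Ring.ord_mul_of_isUnit_right (htunit.pow n), Ring.ord_pow hu0,
    Ring.ord_eq_one_of_isMaximal hmax]
  simp

/-- In the chart, `u ^ m * v ^ n = u ^ (m + n) * (v / u) ^ n`. -/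
theorem pullbackCoeff_exceptionalCurve {N : Node R K} (h : HasParams N.ring N.u N.v) {f : R}
    {m n : ℕ} (hf : algebraMap R K f = N.u ^ m * N.v ^ n) :
    pullbackCoeff N.exceptionalCurve f = (m + n : ℕ) := by
  obtain ⟨u, t, hu, ht, h, hP, htu⟩ := h.exists_chart_params
  have hN : N.u ≠ 0 := by
    rw [← hu]
    exact fun h0 => h.left_ne_zero (Subtype.ext h0)
  have key := ord_localizeAt_singleton h.left_ne_zero hP htu (algebraMap R _ f) (m + n) n (by
    rw [hu, ht]
    refine Eq.trans (b := algebraMap R K f) rfl ?_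
    rw [hf, div_pow, pow_add]
    field_simp)
  rw [hu] at key
  exact key

/-! ## The nodes over the point -/

variable (K) in
/-- The node that is blown up last in the procedure with the given binary sequence. -/
def finalNode (x y : R) (s : List Turn) : Node R K :=
  s.foldl Node.step (Node.base x y)

theorem finalNode_append_singleton (x y : R) (s : List Turn) (t : Turn) :
    finalNode K x y (s ++ [t]) = (finalNode K x y s).step t := by
  simp [finalNode]

theorem IsParamPair.hasParams_base [FaithfulSMul R K] {x y : R} (h : IsParamPair x y) :
    HasParams (Node.base x y : Node R K).ring (algebraMap R K x) (algebraMap R K y) := by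
  have e := (Algebra.botEquivOfInjective (FaithfulSMul.algebraMap_injective R K)).symm
  have he : ∀ r, ((e r : (⊥ : Subalgebra R K)) : K) = algebraMap R K r := by
    intro r
    have : e r = algebraMap R _ r := e.commutes r
    rw [this]; rfl
  exact ⟨e x, e y, he x, he y, h.map_ringEquiv e.toRingEquiv⟩

/-- A monomial in the local equations at a node remains one at the next nodes, with exponents given
by the Farey procedure. -/
theorem pullbackCoeff_foldl {N : Node R K} (h : HasParams N.ring N.u N.v) (s : List Turn) {f : R}
    {m n : ℕ} (hf : algebraMap R K f = N.u ^ m * N.v ^ n) :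
    pullbackCoeff (s.foldl Node.step N).exceptionalCurve f =
      ((fareyCoeffs s).1 * m + (fareyCoeffs s).2 * n : ℕ) := by
  induction s generalizing N m n with
  | nil => simpa [fareyCoeffs] using pullbackCoeff_exceptionalCurve h hf
  | cons t s ih =>
    obtain ⟨u, v, hu, hv, hp⟩ := id h
    have hu0 : N.u ≠ 0 := by
      rw [← hu]
      exact fun h0 => hp.left_ne_zero (Subtype.ext h0)
    have hv0 : N.v ≠ 0 := by
      rw [← hv]
      exact fun h0 => hp.right_ne_zero (Subtype.ext h0)
    rw [List.foldl_cons]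
    cases t
    -- The exponents come from `u ^ m * v ^ n = (u / v) ^ m * v ^ (m + n)`; the other turn is
    -- symmetric.
    · rw [ih (h.step Turn.L) (m := m) (n := m + n)]
      · simp only [fareyCoeffs]
        congr 1
        ring
      · simp only [Node.step, hf, div_pow, pow_add]
        field_simp
    · rw [ih (h.step Turn.R) (m := m + n) (n := n)]
      · simp only [fareyCoeffs]
        congr 1
        ring
      · simp only [Node.step, hf, div_pow, pow_add]
        field_simp

theorem IsParamPair.pullbackCoeff_finalCurve [FaithfulSMul R K] {x y : R} (h : IsParamPair x y)
    (s : List Turn) :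
    pullbackCoeff (finalCurve K x y s) x = (fareyCoeffs s).1 ∧
      pullbackCoeff (finalCurve K x y s) y = (fareyCoeffs s).2 := by
  have h0 := h.hasParams_base (K := K)
  refine ⟨?_, ?_⟩
  · refine (pullbackCoeff_foldl (N := Node.base x y) h0 s (m := 1) (n := 0) ?_).trans (by simp)
    simp [Node.base]
  · refine (pullbackCoeff_foldl (N := Node.base x y) h0 s (m := 0) (n := 1) ?_).trans (by simp)
    simp [Node.base]

/-! ## The visible curves -/

/-- A blowup leaves the other nodes untouched, so each node remembers only its own path of turns and
the order of blowups elsewhere is irrelevant. -/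
theorem IsBlowup.subset_range {x y : R} {nodes : Set (Node R K)} {curves : Set (Subalgebra R K)}
    (h : IsBlowup K x y nodes curves) :
    nodes ⊆ Set.range (finalNode K x y) ∧ curves ⊆ Set.range (finalCurve K x y) := by
  induction h with
  | initial => exact ⟨by simpa using ⟨[], rfl⟩, by simp⟩
  | blowup nodes curves N _ hN ih =>
    obtain ⟨s, rfl⟩ := ih.1 hN
    refine ⟨?_, Set.insert_subset ⟨s, rfl⟩ ih.2⟩
    rintro M (hM | rfl | rfl)
    · exact ih.1 hM.1
    · exact ⟨_, finalNode_append_singleton x y s Turn.L⟩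
    · exact ⟨_, finalNode_append_singleton x y s Turn.R⟩

theorem exists_isBlowup_finalNode_mem (x y : R) (s : List Turn) :
    ∃ nodes curves, IsBlowup K x y nodes curves ∧ finalNode K x y s ∈ nodes := by
  induction s using List.reverseRecOn with
  | nil => exact ⟨_, _, IsBlowup.initial, rfl⟩
  | append_singleton s t ih =>
    obtain ⟨nodes, curves, h, hs⟩ := ih
    refine ⟨_, _, h.blowup _ _ _ hs, Or.inr ?_⟩
    rw [finalNode_append_singleton]
    cases t
    · exact Or.inl rfl
    · exact Or.inr rfl

theorem visibleCurves_eq_range (x y : R) :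
    visibleCurves K x y = Set.range (finalCurve K x y) := by
  apply Set.Subset.antisymm
  · rintro E ⟨nodes, curves, h, hE⟩
    exact h.subset_range.2 hE
  · rintro _ ⟨s, rfl⟩
    obtain ⟨nodes, curves, h, hs⟩ := exists_isBlowup_finalNode_mem (K := K) x y s
    exact ⟨_, _, h.blowup _ _ _ hs, Or.inl rfl⟩

end BlowupGeometry

/-! ### Reduced fractions and the proof of the main theorem -/

theorem bijOn_div_of_coprime : Set.BijOn (fun w : ℕ × ℕ => (w.2 : ℚ) / w.1)
    {w | 0 < w.1 ∧ 0 < w.2 ∧ w.1.Coprime w.2} (Set.Ioi 0) := by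
  refine ⟨?_, ?_, ?_⟩
  · rintro ⟨a, b⟩ ⟨ha, hb, -⟩
    simp only at ha hb
    exact Set.mem_Ioi.2 (by positivity)
  · rintro ⟨a, b⟩ ⟨ha, hb, hab⟩ ⟨c, d⟩ ⟨hc, hd, hcd⟩ h
    simp only at ha hb hab hc hd hcd h
    have h1 := Rat.div_int_inj (a := b) (b := a) (c := d) (d := c) (by exact_mod_cast ha)
      (by exact_mod_cast hc) (by simpa using hab.symm) (by simpa using hcd.symm)
      (by simpa using h)
    simp only [Nat.cast_inj] at h1
    rw [h1.1, h1.2]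
  · intro q hq
    have hq' : 0 < q := hq
    have hnum : 0 < q.num := Rat.num_pos.2 hq'
    refine ⟨(q.den, q.num.natAbs), ⟨q.pos, by omega, q.reduced.symm⟩, ?_⟩
    have : ((q.num.natAbs : ℕ) : ℚ) = (q.num : ℚ) := by
      rw [← Int.cast_natCast, Int.natAbs_of_nonneg hnum.le]
    simp only [this]
    exact Rat.num_div_den q

theorem theorem3p4 {R : Type*} [CommRing R] [IsRegularLocalRing R] (hdim : ringKrullDim R = 2)
    {K : Type*} [Field K] [Algebra R K] [IsFractionRing R K]
    (x y : R) (hxy : IsLocalRing.maximalIdeal R = Ideal.span {x, y}) :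
    -- the chains on the two sides of the final curve, for every binary sequence
    (∀ s : List Turn, ∃ wi wj : ℕ,
      pullbackCoeff (finalCurve K x y s) x = wi ∧
      pullbackCoeff (finalCurve K x y s) y = wj ∧
      chainDet (gammaI s) = wi ∧ chainDet (gammaI s).tail = wj ∧
      chainDet (gammaJ s) = wj ∧ chainDet (gammaJ s).tail = wi ∧
      IsHJChain (gammaI s) ((wj : ℚ) / wi) ∧
      IsHJChain (gammaJ s) ((wi : ℚ) / wj) ∧
      fareyVector s = (wi, wj)) ∧
    -- every visible curve over the point is the final curve for exactly one binary sequence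
    Set.BijOn (fun s => finalCurve K x y s) Set.univ (visibleCurves K x y) ∧
    -- the weight vector is a bijection onto the pairs of coprime positive integers
    Set.BijOn (fun E => ((pullbackCoeff E x).toNat, (pullbackCoeff E y).toNat))
      (visibleCurves K x y) {w : ℕ × ℕ | 0 < w.1 ∧ 0 < w.2 ∧ w.1.Coprime w.2} ∧
    -- equivalently, the fraction is a bijection onto the positive rational numbers
    Set.BijOn (fun E => ((pullbackCoeff E y).toNat : ℚ) / ((pullbackCoeff E x).toNat : ℚ))
      (visibleCurves K x y) (Set.Ioi (0 : ℚ)) := by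
  have hp := IsRegularLocalRing.isParamPair hdim hxy
  have : FaithfulSMul R K := (faithfulSMul_iff_algebraMap_injective R K).2
    (IsFractionRing.injective R K)
  have hw := hp.pullbackCoeff_finalCurve (K := K)
  have hweight : ∀ s, ((pullbackCoeff (finalCurve K x y s) x).toNat,
      (pullbackCoeff (finalCurve K x y s) y).toNat) = fareyCoeffs s := by
    intro s
    rw [(hw s).1, (hw s).2]
    simp
  -- Equal local rings have equal orders of `x` and `y`, and these already determine the sequence.
  have hinj : Function.Injective (finalCurve K x y) := fun s t hst => by
    apply fareyCoeffs_injective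
    rw [← hweight, ← hweight, hst]
  have hbij : Set.BijOn (fun E => ((pullbackCoeff E x).toNat, (pullbackCoeff E y).toNat))
      (visibleCurves K x y) {w : ℕ × ℕ | 0 < w.1 ∧ 0 < w.2 ∧ w.1.Coprime w.2} := by
    rw [visibleCurves_eq_range]
    refine ⟨?_, ?_, ?_⟩
    · rintro _ ⟨s, rfl⟩
      simp only [hweight]
      exact ⟨(fareyCoeffs_pos s).1, (fareyCoeffs_pos s).2, fareyCoeffs_coprime s⟩
    · rintro _ ⟨s, rfl⟩ _ ⟨t, rfl⟩ h
      simp only [hweight] at h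
      rw [fareyCoeffs_injective h]
    · rintro ⟨a, b⟩ ⟨ha, hb, hab⟩
      obtain ⟨s, hs⟩ := exists_fareyCoeffs_eq a b ha hb hab
      exact ⟨_, ⟨s, rfl⟩, by simp only [hweight, hs]⟩
  refine ⟨fun s => ?_, ?_, hbij, bijOn_div_of_coprime.comp hbij⟩
  · obtain ⟨h1, h2, h3, h4, h5, h6⟩ := gamma_spec s
    have hf := fareyVector_eq s
    exact ⟨(fareyVector s).1, (fareyVector s).2, hf ▸ (hw s).1, hf ▸ (hw s).2, h1, h2, h3, h4,
      h5, h6, rfl⟩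
  · rw [visibleCurves_eq_range, ← Set.image_univ]
    exact hinj.injOn.bijOn_image
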